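/- Let $Y_1,Y_2,\dots$ be i.i.d. real random variables, let $1\le\alpha<2$, and suppose that $P(Y_1^2>x)\sim \ell(x)x^{-\alpha}$ as $x\to\infty$, where $\ell$ is slowly varying at infinity (positive and measurable on some half-line, with $\ell(cx)/\ell(x)\to1$ as $x\to\infty$ for every $c>0$). Assume that $\sigma_Y^2:=E Y_1^2<\infty$. Put $V_n=\big(\sum_{k=1}^n Y_k^2\big)^{1/2}$ and $\delta_{1,n}=Y_1/V_n$ (with $\delta_{1,n}=0$ where $V_n=0$). Then, for every $\gamma>\alpha$, $$ n\,E|\delta_{1,n}|^{2\gamma}\;\sim\;\frac{\Gamma(\gamma-\alpha)\,\Gamma(1+\alpha)}{\sigma_Y^{2\alpha}\,\Gamma(\gamma)}\;n^{1-\alpha}\,\ell(n)\qquad(n\to\infty). $$ -/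

import Mathlib

open MeasureTheory ProbabilityTheory Filter Asymptotics

noncomputable section

/-- `ℓ` is slowly varying at infinity: on some half-line it is positive and measurable, and
`ℓ (c * x) / ℓ x → 1` as `x → ∞` for every `c > 0`. -/
structure SlowlyVarying (ℓ : ℝ → ℝ) : Prop where
  pos_measurable : ∃ A : ℝ, (∀ x, A ≤ x → 0 < ℓ x) ∧ Measurable (fun x : Set.Ici A => ℓ x)
  tendsto_ratio : ∀ c : ℝ, 0 < c → Tendsto (fun x : ℝ => ℓ (c * x) / ℓ x) atTop (nhds 1)

/-- The random variables `Y 0, Y 1, …` are independent and identically distributed under `μ`. -/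
structure IsIID {Ω : Type*} [MeasurableSpace Ω] (Y : ℕ → Ω → ℝ) (μ : Measure Ω) : Prop where
  indep : iIndepFun Y μ
  identDistrib : ∀ k, IdentDistrib (Y k) (Y 0) μ μ

/-- `V_n = (∑ Y_k²)^{1/2}`, the sum running over the first `n` variables `Y 0, …, Y (n - 1)`. -/
def selfNorm {Ω : Type*} (Y : ℕ → Ω → ℝ) (n : ℕ) (ω : Ω) : ℝ :=
  Real.sqrt (∑ k ∈ Finset.range n, Y k ω ^ 2)

/-- The normalized variable `Y_k / V_n`, with indices starting at `0`. It is `0` where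
`V_n = 0`. -/
def normalized {Ω : Type*} (Y : ℕ → Ω → ℝ) (k n : ℕ) (ω : Ω) : ℝ :=
  Y k ω / selfNorm Y n ω

end

/-! Put X_k = Y_k², m = E X_0, G(x) = P(X_0 > x), and let S be the sum of X_1, …, X_{n-1}. Then
|δ|^{2γ} = (X_0/(X_0 + S))^γ, where S is independent of X_0 and close to mn, so the idea is to
replace S by a constant s = rn with r near m.

For constant s, the layer cake formula gives E(X_0/(X_0+s))^γ = ∫₀¹ γ v^{γ-1} G(s v/(1-v)) dv.
Dividing by G(s) and using regular variation, with Potter's bound as domination, yields the limit γ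
B(γ-α, 1+α) = Γ(γ-α)Γ(1+α)/Γ(γ) (`tendsto_integral_div_add_rpow`). Since G(rn) ~ r^{-α} G(n),
letting r → m produces the factor m^{-α}.

The two directions of the replacement are not symmetric. The lower bound uses independence and needs
only P(S ≤ rn) → 1 for r > m. The upper bound adds the error P(S ≤ rn) with r < m, which must be
o(G(n)). As the summands are nonnegative, a Chernoff bound makes this error exponentially small,
while G decays only polynomially (`tendsto_integral_share_rpow`). -/

/-! ### Regular variation and Potter's bound -/

/-- A function equivalent to `ℓ x * x ^ (-α)` with `ℓ` slowly varying is eventually positive. -/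
theorem SlowlyVarying.eventually_pos {ℓ G : ℝ → ℝ} {α : ℝ} (hℓ : SlowlyVarying ℓ)
    (hG : G ~[atTop] fun x => ℓ x * x ^ (-α)) : ∀ᶠ x in atTop, 0 < G x := by
  obtain ⟨A, hA, -⟩ := hℓ.pos_measurable
  have hpos : ∀ᶠ x : ℝ in atTop, 0 < ℓ x * x ^ (-α) := by
    filter_upwards [eventually_ge_atTop A, eventually_gt_atTop 0] with x hx hx0
    exact mul_pos (hA x hx) (Real.rpow_pos_of_pos hx0 _)
  have h1 := (isEquivalent_iff_tendsto_one (hpos.mono fun x hx => hx.ne')).1 hG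
  filter_upwards [hpos, h1.eventually (lt_mem_nhds one_pos)] with x hx hx1
  exact (div_pos_iff_of_pos_right hx).1 hx1

/-- A function equivalent to `ℓ x * x ^ (-α)` with `ℓ` slowly varying is regularly varying of
index `-α`. -/
theorem SlowlyVarying.tendsto_ratio_of_isEquivalent {ℓ G : ℝ → ℝ} {α : ℝ} (hℓ : SlowlyVarying ℓ)
    (hG : G ~[atTop] fun x => ℓ x * x ^ (-α)) {c : ℝ} (hc : 0 < c) :
    Tendsto (fun x => G (c * x) / G x) atTop (nhds (c ^ (-α))) := by
  have hcx : Tendsto (fun x : ℝ => c * x) atTop atTop := tendsto_id.const_mul_atTop hc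
  have h := (hG.comp_tendsto hcx).div hG
  refine (h.symm.tendsto_nhds ?_)
  have h2 := (hℓ.tendsto_ratio c hc).mul_const (c ^ (-α))
  rw [one_mul] at h2
  refine h2.congr' ?_
  filter_upwards [eventually_gt_atTop 0] with x hx
  have hxα : x ^ (-α) ≠ 0 := (Real.rpow_pos_of_pos hx _).ne'
  simp only [Function.comp, Pi.div_apply]
  rw [Real.mul_rpow hc.le hx.le, ← mul_assoc, mul_div_mul_right _ _ hxα]
  ring

/-- If doubling the argument costs an antitone function at most a factor `2 ^ β` beyond `x₀`, then
it decays at most polynomially with exponent `β` beyond `x₀`. -/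
theorem Antitone.le_rpow_mul_of_doubling {G : ℝ → ℝ} (hG : Antitone G) (h0 : ∀ x, 0 ≤ G x)
    {β x₀ : ℝ} (hβ : 0 ≤ β) (hx₀ : 0 < x₀) (hd : ∀ x, x₀ ≤ x → G x ≤ 2 ^ β * G (2 * x))
    {x y : ℝ} (hx : x₀ ≤ x) (hxy : x ≤ y) : G x ≤ 2 ^ β * (y / x) ^ β * G y := by
  have hxpos : 0 < x := hx₀.trans_le hx
  have iter : ∀ k : ℕ, G x ≤ ((2 : ℝ) ^ k) ^ β * G (2 ^ k * x) := by
    intro k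
    induction k with
    | zero => simp
    | succ k ih =>
      have h1 : x₀ ≤ 2 ^ k * x :=
        hx.trans (le_mul_of_one_le_left hxpos.le (one_le_pow₀ one_le_two))
      refine ih.trans ?_
      rw [pow_succ, Real.mul_rpow (by positivity) (by norm_num), mul_assoc, mul_comm _ (2 : ℝ),
        mul_assoc (2 : ℝ)]
      exact mul_le_mul_of_nonneg_left (hd _ h1) (by positivity)
  obtain ⟨k, hk1, hk2⟩ := exists_nat_pow_near ((one_le_div hxpos).2 hxy) (one_lt_two (α := ℝ))
  calc G x ≤ ((2 : ℝ) ^ (k + 1)) ^ β * G (2 ^ (k + 1) * x) := iter _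
    _ ≤ ((2 : ℝ) ^ (k + 1)) ^ β * G y :=
        mul_le_mul_of_nonneg_left (hG ((div_lt_iff₀ hxpos).1 hk2).le) (by positivity)
    _ ≤ 2 ^ β * (y / x) ^ β * G y := by
        refine mul_le_mul_of_nonneg_right ?_ (h0 y)
        rw [pow_succ, mul_comm, Real.mul_rpow (by norm_num) (by positivity)]
        gcongr

/-- Potter's bound for an antitone function with values in `[0, 1]`. -/
theorem Antitone.exists_potter_bound {G : ℝ → ℝ} (hG : Antitone G) (h0 : ∀ x, 0 ≤ G x)
    (h1 : ∀ x, G x ≤ 1) (hpos : ∀ᶠ x in atTop, 0 < G x) {α β : ℝ} (hβ : 0 ≤ β) (hαβ : α < β)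
    (hlim : Tendsto (fun x => G (2 * x) / G x) atTop (nhds (2 ^ (-α)))) :
    ∃ K x₀ : ℝ, 0 < K ∧ 0 < x₀ ∧ (∀ x, x₀ ≤ x → 0 < G x) ∧
      ∀ x, x₀ ≤ x → ∀ u, 0 < u → u ≤ 1 → G (u * x) ≤ K * u ^ (-β) * G x := by
  have hlt : (2 : ℝ) ^ (-β) < 2 ^ (-α) := Real.rpow_lt_rpow_of_exponent_lt one_lt_two (by linarith)
  obtain ⟨x₁, hx₁⟩ := eventually_atTop.1 (hpos.and (hlim.eventually (lt_mem_nhds hlt)))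
  set x₀ := max x₁ 1
  have hx₀ : 0 < x₀ := one_pos.trans_le (le_max_right _ _)
  have hGpos : ∀ x, x₀ ≤ x → 0 < G x := fun x hx => (hx₁ x ((le_max_left _ _).trans hx)).1
  have hd : ∀ x, x₀ ≤ x → G x ≤ 2 ^ β * G (2 * x) := by
    intro x hx
    have h := (hx₁ x ((le_max_left _ _).trans hx)).2.le
    rw [le_div_iff₀ (hGpos x hx), Real.rpow_neg (by norm_num),
      inv_mul_le_iff₀ (by positivity)] at h
    exact h
  have hG0 := hGpos x₀ le_rfl
  have hinv : 1 ≤ (G x₀)⁻¹ := (one_le_inv₀ hG0).2 (h1 _)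
  refine ⟨2 ^ β * (G x₀)⁻¹, x₀, by positivity, hx₀, hGpos, fun x hx u hu hu1 => ?_⟩
  have hxpos : 0 < x := hx₀.trans_le hx
  have hGx := h0 x
  rw [Real.rpow_neg hu.le, ← Real.inv_rpow hu.le]
  -- Below `x₀` doubling is unavailable; there `G ≤ 1` is used, and the factor `(G x₀)⁻¹` in the
  -- constant pays for it.
  rcases le_total x₀ (u * x) with h | h
  · have := hG.le_rpow_mul_of_doubling h0 hβ hx₀ hd h (mul_le_of_le_one_left hxpos.le hu1)
    rw [div_mul_cancel_right₀ hxpos.ne'] at this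
    refine this.trans ?_
    refine mul_le_mul_of_nonneg_right ?_ hGx
    refine mul_le_mul_of_nonneg_right ?_ (by positivity)
    exact le_mul_of_one_le_right (by positivity) hinv
  · have h2 := hG.le_rpow_mul_of_doubling h0 hβ hx₀ hd le_rfl hx
    have h3 : x / x₀ ≤ u⁻¹ := by
      rw [div_le_iff₀ hx₀, inv_mul_eq_div, le_div_iff₀ hu]; linarith
    calc G (u * x) ≤ 1 := h1 _
      _ = (G x₀)⁻¹ * G x₀ := (inv_mul_cancel₀ hG0.ne').symm
      _ ≤ (G x₀)⁻¹ * (2 ^ β * (x / x₀) ^ β * G x) := by gcongr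
      _ ≤ (G x₀)⁻¹ * (2 ^ β * u⁻¹ ^ β * G x) := by gcongr
      _ = _ := by ring

/-! ### Moments of X / (X + s) for constant s -/

/-- The real Beta integral in terms of the Gamma function. -/
theorem integral_Ioo_rpow_mul_one_sub_rpow {a b : ℝ} (ha : 0 < a) (hb : 0 < b) :
    ∫ v in Set.Ioo (0 : ℝ) 1, v ^ (a - 1) * (1 - v) ^ (b - 1) =
      Real.Gamma a * Real.Gamma b / Real.Gamma (a + b) := by
  change _ = beta a b
  rw [beta_eq_betaIntegralReal a b ha hb, Complex.betaIntegral,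
    intervalIntegral.integral_of_le (by norm_num), ← integral_Ioc_eq_integral_Ioo,
    ← RCLike.re_to_complex, ← integral_re]
  · refine setIntegral_congr_fun measurableSet_Ioc fun x ⟨hx1, hx2⟩ => ?_
    norm_cast
    rw [← Complex.ofReal_cpow, ← Complex.ofReal_cpow, RCLike.re_to_complex,
      Complex.re_mul_ofReal, Complex.ofReal_re]
    all_goals linarith
  · have h := Complex.betaIntegral_convergent (u := a) (v := b) (by simpa) (by simpa)
    rwa [intervalIntegrable_iff_integrableOn_Ioc_of_le (by simp), IntegrableOn] at h

theorem antitone_measureReal_lt {Ω : Type*} [MeasurableSpace Ω] (μ : Measure Ω)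
    [IsFiniteMeasure μ] (X : Ω → ℝ) : Antitone fun x => μ.real {ω | x < X ω} :=
  fun _ _ hxy => measureReal_mono fun _ hω => lt_of_le_of_lt hxy hω

/-- Layer cake formula for the moments of `X / (X + s)`. -/
theorem integral_div_add_rpow_eq {Ω : Type*} [MeasurableSpace Ω] {μ : Measure Ω}
    [IsProbabilityMeasure μ] {X : Ω → ℝ} (hX : AEMeasurable X μ) (hX0 : ∀ ω, 0 ≤ X ω)
    {s γ : ℝ} (hs : 0 < s) (hγ : 0 < γ) :
    ∫ ω, (X ω / (X ω + s)) ^ γ ∂μ =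
      ∫ v in Set.Ioo (0 : ℝ) 1, γ * v ^ (γ - 1) * μ.real {ω | s * (v / (1 - v)) < X ω} := by
  have hw0 : ∀ ω, 0 ≤ X ω / (X ω + s) := fun ω =>
    div_nonneg (hX0 ω) (add_nonneg (hX0 ω) hs.le)
  have hwm : AEMeasurable (fun ω => X ω / (X ω + s)) μ := hX.div (hX.add_const s)
  have hset : ∀ v, v < 1 → {ω | v < X ω / (X ω + s)} = {ω | s * (v / (1 - v)) < X ω} := by
    intro v hv
    ext ω
    have h1 : 0 < X ω + s := add_pos_of_nonneg_of_pos (hX0 ω) hs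
    have h2 : 0 < 1 - v := sub_pos.2 hv
    simp only [Set.mem_ofPred_eq]
    rw [lt_div_iff₀ h1, ← mul_div_assoc, div_lt_iff₀ h2]
    constructor <;> intro h <;> linarith
  have hempty : ∀ v, 1 ≤ v → {ω | v < X ω / (X ω + s)} = ∅ := by
    intro v hv
    refine Set.eq_empty_iff_forall_notMem.2 fun ω hω => ?_
    have h1 : 0 < X ω + s := add_pos_of_nonneg_of_pos (hX0 ω) hs
    have : X ω / (X ω + s) ≤ 1 := (div_le_one h1).2 (by linarith)
    exact absurd hω (by simpa using this.trans hv)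
  have hmeas : Measurable fun v : ℝ => μ.real {ω | v < X ω / (X ω + s)} :=
    (antitone_measureReal_lt μ _).measurable
  have hcongr : ∫ v in Set.Ioo (0 : ℝ) 1, γ * v ^ (γ - 1) * μ.real {ω | s * (v / (1 - v)) < X ω} =
      ∫ v in Set.Ioo (0 : ℝ) 1, γ * v ^ (γ - 1) * μ.real {ω | v < X ω / (X ω + s)} :=
    setIntegral_congr_fun measurableSet_Ioo fun v hv => by
      simp only [hset v hv.2]
  rw [hcongr, integral_eq_lintegral_of_nonneg_ae
      (Eventually.of_forall fun ω => Real.rpow_nonneg (hw0 ω) _)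
      (hwm.pow_const γ).aestronglyMeasurable,
    integral_eq_lintegral_of_nonneg_ae
      (ae_restrict_of_forall_mem measurableSet_Ioo fun v hv => by
        have := hv.1
        dsimp
        positivity)
      (by fun_prop),
    lintegral_rpow_eq_lintegral_meas_lt_mul μ (Eventually.of_forall hw0) hwm hγ,
    ← lintegral_const_mul' _ _ ENNReal.ofReal_ne_top, ← Set.Ioo_union_Ici_eq_Ioi (zero_lt_one' ℝ),
    lintegral_union measurableSet_Ici (by
      rw [Set.disjoint_left]; intro v h1 h2; exact absurd h1.2 (not_lt.2 h2))]
  rw [setLIntegral_eq_zero measurableSet_Ici (fun v hv => by simp [hempty v hv]), add_zero]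
  congr 1
  refine setLIntegral_congr_fun measurableSet_Ioo fun v hv => ?_
  have hv0 := hv.1
  rw [ENNReal.ofReal_mul (by positivity), ENNReal.ofReal_mul hγ.le, ofReal_measureReal]
  ring

/-- If the tail `P(X > x)` is regularly varying of index `-α`, then `E (X / (X + s)) ^ γ` is
asymptotic to a multiple of `P(X > s)`. -/
theorem tendsto_integral_div_add_rpow {Ω : Type*} [MeasurableSpace Ω] {μ : Measure Ω}
    [IsProbabilityMeasure μ] {X : Ω → ℝ} (hX : AEMeasurable X μ) (hX0 : ∀ ω, 0 ≤ X ω)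
    {α γ : ℝ} (hα : 0 ≤ α) (hγ : α < γ)
    (hpos : ∀ᶠ x in atTop, 0 < μ.real {ω | x < X ω})
    (hlim : ∀ c : ℝ, 0 < c → Tendsto (fun x => μ.real {ω | c * x < X ω} / μ.real {ω | x < X ω})
      atTop (nhds (c ^ (-α)))) :
    Tendsto (fun s => (∫ ω, (X ω / (X ω + s)) ^ γ ∂μ) / μ.real {ω | s < X ω}) atTop
      (nhds (Real.Gamma (γ - α) * Real.Gamma (1 + α) / Real.Gamma γ)) := by
  have hγ0 : 0 < γ := hα.trans_lt hγ
  set G : ℝ → ℝ := fun x => μ.real {ω | x < X ω} with hGdef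
  have hanti : Antitone G := antitone_measureReal_lt μ X
  -- Potter's bound needs `α < β`; integrability of the majorant `v ^ (γ - β - 1)` at 0 needs `β <
  -- γ`.
  obtain ⟨β, hαβ, hβγ⟩ := exists_between hγ
  have hβ : 0 ≤ β := hα.trans hαβ.le
  obtain ⟨K, x₀, hK, hx₀, hGpos, hpotter⟩ := hanti.exists_potter_bound
    (fun x => measureReal_nonneg) (fun x => measureReal_le_one) hpos hβ hαβ (hlim 2 two_pos)
  have hval : Real.Gamma (γ - α) * Real.Gamma (1 + α) / Real.Gamma γ =
      ∫ v in Set.Ioo (0 : ℝ) 1, γ * v ^ (γ - 1) * (v / (1 - v)) ^ (-α) := by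
    have h := integral_Ioo_rpow_mul_one_sub_rpow (a := γ - α) (b := 1 + α) (by linarith)
      (by linarith)
    have h2 : ∫ v in Set.Ioo (0 : ℝ) 1, γ * v ^ (γ - 1) * (v / (1 - v)) ^ (-α) =
        ∫ v in Set.Ioo (0 : ℝ) 1, γ * (v ^ (γ - α - 1) * (1 - v) ^ (1 + α - 1)) := by
      refine setIntegral_congr_fun measurableSet_Ioo fun v hv => ?_
      have hv1 : 0 < 1 - v := sub_pos.2 hv.2
      rw [Real.div_rpow hv.1.le hv1.le, Real.rpow_neg hv1.le, div_inv_eq_mul,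
        show γ - α - 1 = (γ - 1) + (-α) by ring, Real.rpow_add hv.1, add_sub_cancel_left]
      ring
    rw [h2, integral_const_mul, h, show γ - α + (1 + α) = γ + 1 by ring,
      Real.Gamma_add_one hγ0.ne']
    have := (Real.Gamma_pos_of_pos hγ0).ne'
    field_simp
  have hrep : (fun s => ∫ v in Set.Ioo (0 : ℝ) 1,
      γ * v ^ (γ - 1) * (G (s * (v / (1 - v))) / G s)) =ᶠ[atTop]
      fun s => (∫ ω, (X ω / (X ω + s)) ^ γ ∂μ) / G s := by
    filter_upwards [eventually_gt_atTop 0] with s hs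
    rw [integral_div_add_rpow_eq hX hX0 hs hγ0, ← integral_div]
    simp only [mul_div_assoc, hGdef]
  rw [hval]
  refine Tendsto.congr' hrep ?_
  refine tendsto_integral_filter_of_dominated_convergence
    (fun v => γ * K * v ^ (γ - β - 1)) ?_ ?_ ?_ ?_
  · refine Eventually.of_forall fun s => Measurable.aestronglyMeasurable ?_
    have := hanti.measurable
    fun_prop
  · filter_upwards [eventually_ge_atTop x₀] with s hs
    refine ae_restrict_of_forall_mem measurableSet_Ioo fun v hv => ?_
    have hs0 := hx₀.trans_le hs
    have hv0 := hv.1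
    have hv1 : 0 < 1 - v := sub_pos.2 hv.2
    -- Potter's bound covers only factors at most 1, and `v / (1 - v)` is unbounded; by monotonicity
    -- of `G` it may be replaced by `v`.
    have hvu : v ≤ v / (1 - v) := by
      rw [le_div_iff₀ hv1]; nlinarith
    have h1 : G (s * (v / (1 - v))) ≤ K * v ^ (-β) * G s := by
      refine le_trans (hanti ?_) (hpotter s hs v hv.1 hv.2.le)
      rw [mul_comm]
      gcongr
    have h2 : G (s * (v / (1 - v))) / G s ≤ K * v ^ (-β) := (div_le_iff₀ (hGpos s hs)).2 h1
    have h3 : 0 ≤ G (s * (v / (1 - v))) / G s := div_nonneg measureReal_nonneg measureReal_nonneg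
    rw [Real.norm_of_nonneg (by positivity)]
    calc γ * v ^ (γ - 1) * (G (s * (v / (1 - v))) / G s) ≤ γ * v ^ (γ - 1) * (K * v ^ (-β)) := by
          gcongr
      _ = γ * K * v ^ (γ - β - 1) := by
          rw [show γ - β - 1 = (γ - 1) + (-β) by ring, Real.rpow_add hv.1]; ring
  · refine Integrable.const_mul ?_ _
    exact (intervalIntegral.integrableOn_Ioo_rpow_iff one_pos).2 (by linarith)
  · refine ae_restrict_of_forall_mem measurableSet_Ioo fun v hv => ?_
    have hv1 : 0 < 1 - v := sub_pos.2 hv.2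
    refine Tendsto.const_mul _ ?_
    simpa only [mul_comm] using hlim (v / (1 - v)) (div_pos hv.1 hv1)

/-! ### Deviations of sums of nonnegative variables -/

/-- The Laplace transform of a nonnegative integrable variable is below `exp (-c t)` for some
`t > 0`, whenever `c` is below the mean. -/
theorem exists_mgf_neg_le {Ω : Type*} [MeasurableSpace Ω] {μ : Measure Ω}
    [IsProbabilityMeasure μ] {X : Ω → ℝ} (hX0 : ∀ ω, 0 ≤ X ω) (hint : Integrable X μ)
    {c : ℝ} (hc : c < ∫ ω, X ω ∂μ) :
    ∃ t : ℝ, 0 < t ∧ mgf X μ (-t) ≤ Real.exp (-(t * c)) := by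
  have hXm := hint.aemeasurable
  -- The quotient (1 - e^{-tX})/t tends to X as t ↓ 0 and is dominated by X, so its mean eventually
  -- exceeds `c`.
  have hlim : Tendsto (fun t : ℝ => ∫ ω, (1 - Real.exp (-t * X ω)) / t ∂μ) (nhdsWithin 0 (Set.Ioi 0))
      (nhds (∫ ω, X ω ∂μ)) := by
    refine tendsto_integral_filter_of_dominated_convergence X ?_ ?_ hint ?_
    · refine Eventually.of_forall fun t => AEMeasurable.aestronglyMeasurable ?_
      fun_prop
    · filter_upwards [self_mem_nhdsWithin] with t ht
      refine Eventually.of_forall fun ω => ?_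
      have ht : 0 < t := ht
      have h1 : Real.exp (-t * X ω) ≤ 1 :=
        Real.exp_le_one_iff.2 (by have := mul_nonneg ht.le (hX0 ω); linarith)
      rw [Real.norm_of_nonneg (div_nonneg (by linarith) ht.le), div_le_iff₀ ht]
      have := Real.add_one_le_exp (-t * X ω)
      linarith
    · refine Eventually.of_forall fun ω => ?_
      have hd : HasDerivAt (fun t : ℝ => 1 - Real.exp (-t * X ω)) (X ω) 0 := by
        have h := (((hasDerivAt_id (0 : ℝ)).neg.mul_const (X ω)).exp).const_sub 1
        simpa using h
      have := (hasDerivAt_iff_tendsto_slope.1 hd).mono_left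
        (nhdsWithin_mono 0 (fun t (ht : t ∈ Set.Ioi (0 : ℝ)) => (ne_of_gt ht : t ≠ 0)))
      refine this.congr fun t => ?_
      simp [slope_def_field]
  obtain ⟨t, ht1, ht2⟩ := ((hlim.eventually (lt_mem_nhds hc)).and self_mem_nhdsWithin).exists
  have ht2 : 0 < t := ht2
  refine ⟨t, ht2, ?_⟩
  have hi : Integrable (fun ω => Real.exp (-t * X ω)) μ := by
    refine Integrable.of_bound (C := 1) (by fun_prop) (Eventually.of_forall fun ω => ?_)
    rw [Real.norm_of_nonneg (Real.exp_pos _).le]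
    exact Real.exp_le_one_iff.2 (by have := mul_nonneg ht2.le (hX0 ω); linarith)
  rw [integral_div, lt_div_iff₀ ht2, integral_sub (integrable_const _) hi] at ht1
  simp only [integral_const, probReal_univ, smul_eq_mul, mul_one] at ht1
  have := Real.add_one_le_exp (-(t * c))
  rw [mgf]
  linarith

/-- Sums of nonnegative i.i.d. variables have exponentially small probability of falling linearly
below their mean. -/
theorem exists_measureReal_sum_le_le_exp {Ω : Type*} [MeasurableSpace Ω] {μ : Measure Ω}
    [IsProbabilityMeasure μ] {X : ℕ → Ω → ℝ} (hindep : iIndepFun X μ)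
    (hident : ∀ k, IdentDistrib (X k) (X 0) μ μ) (hX0 : ∀ k ω, 0 ≤ X k ω)
    (hint : Integrable (X 0) μ) {r : ℝ} (hr : r < ∫ ω, X 0 ω ∂μ) :
    ∃ C b : ℝ, 0 < b ∧ ∀ n : ℕ,
      μ.real {ω | ∑ k ∈ Finset.Ico 1 n, X k ω ≤ r * n} ≤ C * Real.exp (-b * n) := by
  obtain ⟨c, hrc, hc⟩ := exists_between hr
  obtain ⟨t, ht, hmgf⟩ := exists_mgf_neg_le (hX0 0) hint hc
  have hXm : ∀ k, AEMeasurable (X k) μ := fun k => (hident k).aemeasurable_fst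
  -- `exp (t * c)` compensates for having `n - 1` summands instead of `n`; the 1 covers `n = 0`.
  refine ⟨max 1 (Real.exp (t * c)), t * (c - r), mul_pos ht (sub_pos.2 hrc), fun n => ?_⟩
  rcases Nat.eq_zero_or_pos n with rfl | hn
  · simp
  have hSm : AEMeasurable (∑ k ∈ Finset.Ico 1 n, X k) μ := Finset.aemeasurable_sum _ fun k _ => hXm k
  have hS0 : ∀ ω, 0 ≤ (∑ k ∈ Finset.Ico 1 n, X k) ω := fun ω => by
    rw [Finset.sum_apply]; exact Finset.sum_nonneg fun k _ => hX0 k ω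
  have hi : Integrable (fun ω => Real.exp (-t * (∑ k ∈ Finset.Ico 1 n, X k) ω)) μ := by
    refine Integrable.of_bound (C := 1) (by fun_prop) (Eventually.of_forall fun ω => ?_)
    rw [Real.norm_of_nonneg (Real.exp_pos _).le]
    exact Real.exp_le_one_iff.2 (by have := mul_nonneg ht.le (hS0 ω); linarith)
  have h := measure_le_le_exp_mul_mgf (X := ∑ k ∈ Finset.Ico 1 n, X k) (μ := μ) (r * n)
    (neg_nonpos.2 ht.le) hi
  rw [hindep.mgf_sum₀ hXm, Finset.prod_congr rfl
    (fun k _ => mgf_congr_of_identDistrib (X k) (X 0) (hident k) (-t)), Finset.prod_const,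
    Nat.card_Ico] at h
  simp only [Finset.sum_apply] at h
  refine h.trans ?_
  calc Real.exp (- -t * (r * n)) * mgf (X 0) μ (-t) ^ (n - 1)
      ≤ Real.exp (- -t * (r * n)) * Real.exp (-(t * c)) ^ (n - 1) := by
        gcongr
        exact mgf_nonneg
    _ = Real.exp (t * c) * Real.exp (-(t * (c - r)) * n) := by
        rw [← Real.exp_nat_mul, ← Real.exp_add, ← Real.exp_add, Nat.cast_sub hn]
        congr 1
        push_cast
        ring
    _ ≤ _ := by
        gcongr
        exact le_max_right _ _

/-- Weak law of large numbers, upper half: the sum is below `r n` with probability tending to one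
if `r` exceeds the mean. -/
theorem tendsto_measureReal_sum_le {Ω : Type*} [MeasurableSpace Ω] {μ : Measure Ω}
    [IsProbabilityMeasure μ] {X : ℕ → Ω → ℝ} (hindep : iIndepFun X μ)
    (hident : ∀ k, IdentDistrib (X k) (X 0) μ μ) (hX0 : ∀ k ω, 0 ≤ X k ω)
    (hint : Integrable (X 0) μ) {r : ℝ} (hr : ∫ ω, X 0 ω ∂μ < r) :
    Tendsto (fun n : ℕ => μ.real {ω | ∑ k ∈ Finset.Ico 1 n, X k ω ≤ r * n}) atTop (nhds 1) := by
  have hXm : ∀ k, AEMeasurable (X k) μ := fun k => (hident k).aemeasurable_fst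
  have hslln := strong_law_ae_real X hint (fun i j hij => hindep.indepFun hij) hident
  have hmeas : ∀ n, NullMeasurableSet {ω | ∑ k ∈ Finset.Ico 1 n, X k ω ≤ r * n} μ := fun n =>
    nullMeasurableSet_le (Finset.aemeasurable_fun_sum _ fun k _ => hXm k) aemeasurable_const
  have h : Tendsto (fun n : ℕ => ∫ ω, Set.indicator {ω | ∑ k ∈ Finset.Ico 1 n, X k ω ≤ r * n}
      (fun _ => (1 : ℝ)) ω ∂μ) atTop (nhds (∫ _, (1 : ℝ) ∂μ)) := by
    refine tendsto_integral_of_dominated_convergence (fun _ => 1) (fun n => ?_)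
      (integrable_const _) (fun n => Eventually.of_forall fun ω => ?_) ?_
    · exact aestronglyMeasurable_const.indicator₀ (hmeas n)
    · exact (norm_indicator_le_norm_self _ _).trans (by simp)
    · filter_upwards [hslln] with ω hω
      refine tendsto_const_nhds.congr' ?_
      filter_upwards [hω.eventually (gt_mem_nhds hr), eventually_gt_atTop 0] with n hn hn0
      rw [Set.indicator_of_mem]
      have hn0 : (0 : ℝ) < n := Nat.cast_pos.2 hn0
      refine le_trans ?_ ((div_lt_iff₀ hn0).1 hn).le
      refine Finset.sum_le_sum_of_subset_of_nonneg (fun k hk => ?_) fun k _ _ => hX0 k ω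
      simp only [Finset.mem_Ico, Finset.mem_range] at hk ⊢
      exact hk.2
  simpa [integral_indicator₀ (hmeas _)] using h

/-! ### The share of one variable in the sum -/

section Ratio

variable {Ω : Type*} [MeasurableSpace Ω] {μ : Measure Ω} [IsProbabilityMeasure μ]

theorem div_add_rpow_nonneg {x s γ : ℝ} (hx : 0 ≤ x) (hs : 0 ≤ s) : 0 ≤ (x / (x + s)) ^ γ :=
  Real.rpow_nonneg (div_nonneg hx (add_nonneg hx hs)) _

theorem div_add_rpow_le_one {x s γ : ℝ} (hx : 0 ≤ x) (hs : 0 ≤ s) (hγ : 0 ≤ γ) :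
    (x / (x + s)) ^ γ ≤ 1 :=
  Real.rpow_le_one (div_nonneg hx (add_nonneg hx hs))
    (div_le_one_of_le₀ (le_add_of_nonneg_right hs) (add_nonneg hx hs)) hγ

theorem div_add_rpow_le_div_add_rpow {x s t γ : ℝ} (hx : 0 ≤ x) (hs : 0 < s) (hst : s ≤ t)
    (hγ : 0 ≤ γ) : (x / (x + t)) ^ γ ≤ (x / (x + s)) ^ γ := by
  have ht := hs.trans_le hst
  gcongr

theorem integrable_div_add_rpow {X S : Ω → ℝ} (hX : AEMeasurable X μ) (hS : AEMeasurable S μ)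
    (hX0 : ∀ ω, 0 ≤ X ω) (hS0 : ∀ ω, 0 ≤ S ω) {γ : ℝ} (hγ : 0 ≤ γ) :
    Integrable (fun ω => (X ω / (X ω + S ω)) ^ γ) μ := by
  refine Integrable.of_bound (C := 1)
    ((hX.div (hX.add hS)).pow_const γ).aestronglyMeasurable (Eventually.of_forall fun ω => ?_)
  rw [Real.norm_of_nonneg (div_add_rpow_nonneg (hX0 ω) (hS0 ω))]
  exact div_add_rpow_le_one (hX0 ω) (hS0 ω) hγ

/-- The share decreases in the denominator where `S > s`, and is at most 1 elsewhere. No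
independence is needed. -/
theorem integral_div_add_rpow_le {X S : Ω → ℝ} (hX : AEMeasurable X μ) (hS : AEMeasurable S μ)
    (hX0 : ∀ ω, 0 ≤ X ω) (hS0 : ∀ ω, 0 ≤ S ω) {s γ : ℝ} (hs : 0 < s) (hγ : 0 ≤ γ) :
    ∫ ω, (X ω / (X ω + S ω)) ^ γ ∂μ ≤
      ∫ ω, (X ω / (X ω + s)) ^ γ ∂μ + μ.real {ω | S ω ≤ s} := by
  have hmeas : NullMeasurableSet {ω | S ω ≤ s} μ := nullMeasurableSet_le hS aemeasurable_const
  have hi := integrable_div_add_rpow hX (aemeasurable_const (b := s)) hX0 (fun _ => hs.le) hγ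
  have hind : Integrable (Set.indicator {ω | S ω ≤ s} fun _ => (1 : ℝ)) μ :=
    (integrable_const _).indicator₀ hmeas
  have h1 : μ.real {ω | S ω ≤ s} = ∫ ω, Set.indicator {ω | S ω ≤ s} (fun _ => (1 : ℝ)) ω ∂μ := by
    simp [integral_indicator₀ hmeas]
  rw [h1, ← integral_add hi hind]
  refine integral_mono (integrable_div_add_rpow hX hS hX0 hS0 hγ) (hi.add hind) fun ω => ?_
  by_cases hω : S ω ≤ s
  · have h2 := div_add_rpow_nonneg (γ := γ) (hX0 ω) hs.le
    have h3 := div_add_rpow_le_one (hX0 ω) (hS0 ω) hγ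
    dsimp only
    rw [Set.indicator_of_mem (by exact hω)]
    linarith
  · dsimp only
    rw [Set.indicator_of_notMem (by exact hω), add_zero]
    exact div_add_rpow_le_div_add_rpow (hX0 ω) hs (not_le.1 hω).le hγ

/-- Discarding the event `S > s` and enlarging `S` to `s` on the rest only lowers the integral;
independence then factors it. -/
theorem mul_measureReal_le_integral_div_add_rpow {X S : Ω → ℝ} (hX : AEMeasurable X μ)
    (hS : AEMeasurable S μ) (hind : IndepFun S X μ) (hX0 : ∀ ω, 0 ≤ X ω) (hS0 : ∀ ω, 0 ≤ S ω)
    {s γ : ℝ} (hs : 0 < s) (hγ : 0 < γ) :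
    (∫ ω, (X ω / (X ω + s)) ^ γ ∂μ) * μ.real {ω | S ω ≤ s} ≤
      ∫ ω, (X ω / (X ω + S ω)) ^ γ ∂μ := by
  have hmeas : NullMeasurableSet {ω | S ω ≤ s} μ := nullMeasurableSet_le hS aemeasurable_const
  have hi := integrable_div_add_rpow hX (aemeasurable_const (b := s)) hX0 (fun _ => hs.le) hγ.le
  set g : ℝ → ℝ := Set.indicator (Set.Iic s) fun _ => 1
  have hg : Measurable g := measurable_const.indicator measurableSet_Iic
  have hgS : (fun ω => g (S ω)) = Set.indicator {ω | S ω ≤ s} fun _ => (1 : ℝ) := rfl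
  have h1 : μ.real {ω | S ω ≤ s} = ∫ ω, g (S ω) ∂μ := by
    rw [hgS]; simp [integral_indicator₀ hmeas]
  have hf : Measurable fun x : ℝ => (x / (x + s)) ^ γ := by fun_prop
  have hindep : IndepFun (fun ω => (X ω / (X ω + s)) ^ γ) (fun ω => g (S ω)) μ :=
    hind.symm.comp hf hg
  rw [h1, ← hindep.integral_fun_mul_eq_mul_integral hi.aestronglyMeasurable
    (hg.comp_aemeasurable hS).aestronglyMeasurable]
  refine integral_mono_of_nonneg (Eventually.of_forall fun ω => ?_)
    (integrable_div_add_rpow hX hS hX0 hS0 hγ.le) (Eventually.of_forall fun ω => ?_)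
  · exact mul_nonneg (div_add_rpow_nonneg (hX0 ω) hs.le)
      (Set.indicator_nonneg (fun _ _ => zero_le_one) _)
  · by_cases hω : S ω ≤ s
    · have hgω : g (S ω) = 1 := Set.indicator_of_mem (by exact hω) _
      simp only [hgω, mul_one]
      rcases (hX0 ω).eq_or_lt with h0 | h0
      · simp [← h0]
      · have := hX0 ω
        have := hS0 ω
        gcongr
    · have hgω : g (S ω) = 0 := Set.indicator_of_notMem (by exact hω) _
      simp only [hgω, mul_zero]
      exact div_add_rpow_nonneg (hX0 ω) (hS0 ω)

/-- For nonnegative i.i.d. variables with regularly varying tail and finite positive mean, the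
moments of the share of one variable in the sum are asymptotic to a multiple of the tail. -/
theorem tendsto_integral_share_rpow {X : ℕ → Ω → ℝ} (hindep : iIndepFun X μ)
    (hident : ∀ k, IdentDistrib (X k) (X 0) μ μ) (hX0 : ∀ k ω, 0 ≤ X k ω)
    (hint : Integrable (X 0) μ) (hm : 0 < ∫ ω, X 0 ω ∂μ) {α γ : ℝ} (hα : 0 ≤ α) (hγ : α < γ)
    (hpos : ∀ᶠ x in atTop, 0 < μ.real {ω | x < X 0 ω})
    (hlim : ∀ c : ℝ, 0 < c →
      Tendsto (fun x => μ.real {ω | c * x < X 0 ω} / μ.real {ω | x < X 0 ω})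
        atTop (nhds (c ^ (-α)))) :
    Tendsto (fun n : ℕ => (∫ ω, (X 0 ω / ∑ k ∈ Finset.range n, X k ω) ^ γ ∂μ) /
        μ.real {ω | (n : ℝ) < X 0 ω}) atTop
      (nhds (Real.Gamma (γ - α) * Real.Gamma (1 + α) / Real.Gamma γ *
        (∫ ω, X 0 ω ∂μ) ^ (-α))) := by
  have hγ0 : 0 < γ := hα.trans_lt hγ
  have hXm : ∀ k, AEMeasurable (X k) μ := fun k => (hident k).aemeasurable_fst
  set m := ∫ ω, X 0 ω ∂μ
  set C := Real.Gamma (γ - α) * Real.Gamma (1 + α) / Real.Gamma γ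
  set G : ℝ → ℝ := fun x => μ.real {ω | x < X 0 ω} with hGdef
  set f : ℝ → ℝ := fun s => ∫ ω, (X 0 ω / (X 0 ω + s)) ^ γ ∂μ with hfdef
  set S : ℕ → Ω → ℝ := fun n ω => ∑ k ∈ Finset.Ico 1 n, X k ω with hSdef
  have hS0 : ∀ n ω, 0 ≤ S n ω := fun n ω => Finset.sum_nonneg fun k _ => hX0 k ω
  have hSm : ∀ n, AEMeasurable (S n) μ := fun n => Finset.aemeasurable_fun_sum _ fun k _ => hXm k
  have hSX : ∀ n, IndepFun (S n) (X 0) μ := fun n => by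
    have h := hindep.indepFun_finsetSum_of_notMem₀ hXm (s := Finset.Ico 1 n) (i := 0) (by simp)
    have h2 : S n = ∑ k ∈ Finset.Ico 1 n, X k := by ext ω; simp [hSdef]
    rwa [h2]
  have hsplit : ∀ n : ℕ, 0 < n →
      ∫ ω, (X 0 ω / ∑ k ∈ Finset.range n, X k ω) ^ γ ∂μ =
        ∫ ω, (X 0 ω / (X 0 ω + S n ω)) ^ γ ∂μ := by
    intro n hn
    simp only [hSdef, Finset.range_eq_Ico, Finset.sum_eq_sum_Ico_succ_bot hn, zero_add]
  have hnat : Tendsto (fun n : ℕ => (n : ℝ)) atTop atTop := tendsto_natCast_atTop_atTop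
  have hGn : ∀ᶠ n : ℕ in atTop, 0 < G n := hnat.eventually hpos
  have hfr : ∀ r : ℝ, 0 < r →
      Tendsto (fun n : ℕ => f (r * n) / G n) atTop (nhds (C * r ^ (-α))) := by
    intro r hr
    have hrx : Tendsto (fun x : ℝ => r * x) atTop atTop := tendsto_id.const_mul_atTop hr
    have h1 := (tendsto_integral_div_add_rpow (hXm 0) (hX0 0) hα hγ hpos hlim).comp (hrx.comp hnat)
    have h2 := h1.mul ((hlim r hr).comp hnat)
    refine h2.congr' ?_
    filter_upwards [(hrx.comp hnat).eventually hpos] with n hn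
    exact div_mul_div_cancel₀ (ne_of_gt hn)
  have hcont : ContinuousAt (fun r : ℝ => C * r ^ (-α)) m :=
    continuousAt_const.mul (Real.continuousAt_rpow_const _ _ (Or.inl hm.ne'))
  -- By continuity of `r ^ (-α)` at `m`, `r` can be taken slightly above `m` for the lower bound and
  -- slightly below for the upper.
  refine tendsto_order.2 ⟨fun b hb => ?_, fun b hb => ?_⟩
  · obtain ⟨r, hr, hmr⟩ := (((hcont.eventually (lt_mem_nhds hb)).filter_mono
      (nhdsWithin_le_nhds (s := Set.Ioi m))).and self_mem_nhdsWithin).exists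
    have hmr : m < r := hmr
    have hr0 := hm.trans hmr
    have h := (hfr r hr0).mul (tendsto_measureReal_sum_le hindep hident hX0 hint hmr)
    rw [mul_one] at h
    filter_upwards [h.eventually (lt_mem_nhds hr), hGn, eventually_gt_atTop 0] with n h1 h2 hn
    refine h1.trans_le ?_
    rw [div_mul_eq_mul_div, hsplit n hn]
    exact div_le_div_of_nonneg_right (mul_measureReal_le_integral_div_add_rpow (hXm 0) (hSm n)
      (hSX n) (hX0 0) (hS0 n) (mul_pos hr0 (Nat.cast_pos.2 hn)) hγ0) h2.le
  · obtain ⟨r, ⟨hr, hr0⟩, hmr⟩ := ((((hcont.eventually (gt_mem_nhds hb)).and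
      (lt_mem_nhds hm)).filter_mono
      (nhdsWithin_le_nhds (s := Set.Iio m))).and self_mem_nhdsWithin).exists
    have hmr : r < m := hmr
    have hsmall : Tendsto (fun n : ℕ => μ.real {ω | S n ω ≤ r * n} / G n) atTop (nhds 0) := by
      obtain ⟨D, b, hb0, hD⟩ := exists_measureReal_sum_le_le_exp hindep hident hX0 hint hmr
      have hanti : Antitone G := antitone_measureReal_lt μ (X 0)
      obtain ⟨K, x₀, hK, hx₀, hGpos, hpotter⟩ := hanti.exists_potter_bound
        (fun x => measureReal_nonneg) (fun x => measureReal_le_one) hpos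
        (show (0 : ℝ) ≤ α + 1 by linarith) (lt_add_one α) (hlim 2 two_pos)
      have h1 := ((tendsto_rpow_mul_exp_neg_mul_atTop_nhds_zero (α + 1) b hb0).comp hnat).const_mul
        (D * (K * x₀ ^ (-(α + 1)) / G x₀))
      rw [mul_zero] at h1
      refine squeeze_zero' (Eventually.of_forall fun n =>
        div_nonneg measureReal_nonneg measureReal_nonneg) ?_ h1
      filter_upwards [hnat.eventually (eventually_ge_atTop x₀)] with n hn
      have hn0 : (0 : ℝ) < n := hx₀.trans_le hn
      have hGx := hGpos x₀ le_rfl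
      have hGn := hGpos n hn
      -- With `u = x₀ / n`, Potter's bound compares `G n` to the fixed value `G x₀`, so `1 / G n`
      -- grows at most like `n ^ (α + 1)`.
      have hp := hpotter n hn (x₀ / n) (by positivity) ((div_le_one hn0).2 hn)
      rw [div_mul_cancel₀ _ hn0.ne', Real.div_rpow hx₀.le hn0.le, Real.rpow_neg hn0.le,
        div_inv_eq_mul] at hp
      have hinv : (G n)⁻¹ ≤ K * x₀ ^ (-(α + 1)) / G x₀ * (n : ℝ) ^ (α + 1) := by
        rw [inv_le_iff_one_le_mul₀ hGn, div_mul_eq_mul_div, div_mul_eq_mul_div, one_le_div hGx]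
        linarith
      have hD0 : 0 ≤ D * Real.exp (-b * n) := measureReal_nonneg.trans (hD n)
      calc μ.real {ω | S n ω ≤ r * n} / G n
          ≤ D * Real.exp (-b * n) * (G n)⁻¹ := by
            rw [div_eq_mul_inv]
            exact mul_le_mul_of_nonneg_right (hD n) (inv_nonneg.2 hGn.le)
        _ ≤ D * Real.exp (-b * n) * (K * x₀ ^ (-(α + 1)) / G x₀ * (n : ℝ) ^ (α + 1)) :=
            mul_le_mul_of_nonneg_left hinv hD0
        _ = _ := by simp only [Function.comp]; ring
    have h := (hfr r hr0).add hsmall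
    rw [add_zero] at h
    filter_upwards [h.eventually (gt_mem_nhds hr), hGn, eventually_gt_atTop 0] with n h1 h2 hn
    refine lt_of_le_of_lt ?_ h1
    rw [← add_div, hsplit n hn]
    exact div_le_div_of_nonneg_right (integral_div_add_rpow_le (hXm 0) (hSm n)
      (hX0 0) (hS0 n) (mul_pos hr0 (Nat.cast_pos.2 hn)) hγ0.le) h2.le

end Ratio

/-! ### Return to the self-normalized variables -/

theorem abs_normalized_rpow {Ω : Type*} (Y : ℕ → Ω → ℝ) (k n : ℕ) (ω : Ω) (γ : ℝ) :
    |normalized Y k n ω| ^ (2 * γ) = (Y k ω ^ 2 / ∑ j ∈ Finset.range n, Y j ω ^ 2) ^ γ := by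
  rw [Real.rpow_mul (abs_nonneg _), Real.rpow_two, sq_abs, normalized, selfNorm, div_pow,
    Real.sq_sqrt (Finset.sum_nonneg fun j _ => sq_nonneg _)]

theorem mainTheorem6 {Ω : Type*} [MeasurableSpace Ω] (μ : Measure Ω) [IsProbabilityMeasure μ]
    (Y : ℕ → Ω → ℝ) (hY : IsIID Y μ)
    (α : ℝ) (hα₁ : 1 ≤ α) (hα₂ : α < 2)
    (ℓ : ℝ → ℝ) (hℓ : SlowlyVarying ℓ)
    (htail : (fun x : ℝ => μ.real {ω | x < Y 0 ω ^ 2}) ~[atTop] (fun x : ℝ => ℓ x * x ^ (-α)))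
    (hvar : Integrable (fun ω => Y 0 ω ^ 2) μ)
    (γ : ℝ) (hγ : α < γ) :
    (fun n : ℕ => (n : ℝ) * ∫ ω, |normalized Y 0 n ω| ^ (2 * γ) ∂μ) ~[atTop]
      (fun n : ℕ => Real.Gamma (γ - α) * Real.Gamma (1 + α) /
          ((∫ ω, Y 0 ω ^ 2 ∂μ) ^ α * Real.Gamma γ) *
        (n : ℝ) ^ (1 - α) * ℓ (n : ℝ)) := by
  have hα0 : 0 ≤ α := by linarith
  have hsq : Measurable fun x : ℝ => x ^ 2 := by fun_prop
  have hnat : Tendsto (fun n : ℕ => (n : ℝ)) atTop atTop := tendsto_natCast_atTop_atTop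
  have hpos := hℓ.eventually_pos htail
  -- The eventually positive tail rules out `Y 0 = 0` almost surely.
  have hm : 0 < ∫ ω, Y 0 ω ^ 2 ∂μ := by
    obtain ⟨x, hx, hx0⟩ := (hpos.and (eventually_ge_atTop 0)).exists
    rw [integral_pos_iff_support_of_nonneg (fun ω => sq_nonneg _) hvar]
    refine lt_of_lt_of_le (ENNReal.toReal_pos_iff.1 hx).1 (measure_mono fun ω hω => ?_)
    exact ne_of_gt (lt_of_le_of_lt hx0 hω)
  have h := tendsto_integral_share_rpow (X := fun k ω => Y k ω ^ 2)
    (hY.indep.comp (fun _ x => x ^ 2) fun _ => hsq) (fun k => (hY.identDistrib k).comp hsq)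
    (fun k ω => sq_nonneg _) hvar hm hα0 hγ hpos
    (fun c hc => hℓ.tendsto_ratio_of_isEquivalent htail hc)
  set m := ∫ ω, Y 0 ω ^ 2 ∂μ
  have hC : 0 < Real.Gamma (γ - α) * Real.Gamma (1 + α) / Real.Gamma γ * m ^ (-α) := by
    have h1 := Real.Gamma_pos_of_pos (sub_pos.2 hγ)
    have h2 := Real.Gamma_pos_of_pos (show 0 < 1 + α by linarith)
    have h3 := Real.Gamma_pos_of_pos (hα0.trans_lt hγ)
    positivity
  have heq : (fun n : ℕ => (∫ ω, (Y 0 ω ^ 2 / ∑ k ∈ Finset.range n, Y k ω ^ 2) ^ γ ∂μ) /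
      μ.real {ω | (n : ℝ) < Y 0 ω ^ 2}) ~[atTop]
      fun _ => Real.Gamma (γ - α) * Real.Gamma (1 + α) / Real.Gamma γ * m ^ (-α) :=
    (isEquivalent_const_iff_tendsto hC.ne').2 h
  have hprod := (IsEquivalent.refl (u := fun n : ℕ => (n : ℝ)) (l := atTop)).mul
    (heq.mul (htail.comp_tendsto hnat))
  refine (hprod.congr_left ?_).congr_right ?_
  · filter_upwards [hnat.eventually hpos] with n hn
    simp only [Pi.mul_apply, Function.comp, abs_normalized_rpow]
    rw [div_mul_cancel₀ _ (ne_of_gt hn)]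
  · filter_upwards [eventually_gt_atTop 0] with n hn
    have hn : (0 : ℝ) < n := Nat.cast_pos.2 hn
    simp only [Pi.mul_apply, Function.comp]
    rw [sub_eq_add_neg 1 α, Real.rpow_add hn, Real.rpow_one, Real.rpow_neg hm.le, mul_comm (m ^ α),
      ← div_div, div_eq_mul_inv _ (m ^ α)]
    ring
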